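/- Let $\Omega$ be a Polish space or a $\sigma$-compact, locally compact Hausdorff space, and let $C_b(\Omega)$ be the Banach space of bounded continuous functions $f:\Omega\to\mathbb R$ with the sup-norm $\|\cdot\|_\infty$. Let $\tau_c$ be the compact-open topology on $C_b(\Omega)$, generated by the seminorms $p_K(f)=\sup_{x\in K}|f(x)|$ with $K\subseteq\Omega$ compact ($p_\emptyset:=0$), and let $\beta_0$ be the mixed (strict) topology on $C_b(\Omega)$, generated by the seminorms $f\mapsto\sup_{n\in\mathbb N}a_n\,p_{K_n}(f)$, where $(K_n)$ is a sequence of compact subsets of $\Omega$ and $(a_n)$ is a sequence of nonnegative reals converging to $0$. For each $t\ge 0$ let $T(t)$ be a bounded linear operator on $C_b(\Omega)$ (no semigroup law is assumed), such that 1. for every $f\in C_b(\Omega)$ the map $[0,\infty)\ni t\mapsto T(t)f$ is $\tau_c$-continuous; 2. $\sup_{t\in[a,b]}\|T(t)\|<\infty$ for every compact interval $[a,b]\subseteq[0,\infty)$; 3. for every $t\ge 0$, $T(t)$ maps sup-norm bounded $\tau_c$-null sequences to $\tau_c$-null sequences. Then for every compact $K\subseteq\Omega$, every $\varepsilon>0$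 and every compact interval $[a,b]\subseteq[0,\infty)$ there exist $M>0$ and a compact $K'\subseteq\Omega$ such that $$\sup_{x\in K}|(T(t)f)(x)|\le M\sup_{x\in K'}|f(x)|+\varepsilon\|f\|_\infty\qquad\text{for all } t\in[a,b],\ f\in C_b(\Omega).$$ Moreover, $T$ is locally $\beta_0$-equicontinuous: for every compact interval $[a,b]\subseteq[0,\infty)$ and every $\beta_0$-neighbourhood $V$ of $0$ there is a $\beta_0$-neighbourhood $U$ of $0$ with $T(t)U\subseteq V$ for all $t\in[a,b]$. Also, $T$ is locally $\tau_c$-bi-equicontinuous: for every sup-norm bounded $\tau_c$-null sequence $(f_n)$ in $C_b(\Omega)$, $T(t)f_n\to 0$ in $\tau_c$ uniformly for $t$ in compact intervals of $[0,\infty)$. -/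

import Mathlib

open Filter Topology TopologicalSpace Set
open scoped NNReal BoundedContinuousFunction

namespace CbSemigroup

variable {Ω : Type*} [TopologicalSpace Ω]

/-- The values `|f x|`, `x ∈ K`, are bounded, so that their supremum is the genuine one. -/
theorem bddAbove_abs (s : Set Ω) (f : Ω →ᵇ ℝ) : BddAbove (range fun x : s => |f x|) :=
  ⟨‖f‖, by rintro _ ⟨x, rfl⟩; exact f.norm_coe_le_norm x⟩

theorem iSup_abs_nonneg (s : Set Ω) (f : Ω →ᵇ ℝ) : 0 ≤ ⨆ x : s, |f x| :=
  Real.iSup_nonneg fun _ => abs_nonneg _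

theorem iSup_abs_le_norm (s : Set Ω) (f : Ω →ᵇ ℝ) : ⨆ x : s, |f x| ≤ ‖f‖ :=
  Real.iSup_le (fun x => f.norm_coe_le_norm x) (norm_nonneg f)

/-- The seminorm `p_K(f) = sup_{x ∈ K} |f(x)|` on `C_b(Ω)`, for a compact set `K`
(it is `0` if `K` is empty). -/
noncomputable def supSeminorm (K : Compacts Ω) : Seminorm ℝ (Ω →ᵇ ℝ) :=
  Seminorm.of (fun f => ⨆ x : (K : Set Ω), |f x|)
    (fun f g => Real.iSup_le
      (fun x => (abs_add_le (f x) (g x)).trans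
        (add_le_add (le_ciSup (bddAbove_abs _ f) x) (le_ciSup (bddAbove_abs _ g) x)))
      (add_nonneg (iSup_abs_nonneg _ f) (iSup_abs_nonneg _ g)))
    (fun c f => by
      simp only [BoundedContinuousFunction.coe_smul, smul_eq_mul, abs_mul, Real.norm_eq_abs]
      exact (Real.mul_iSup_of_nonneg (abs_nonneg c) _).symm)

theorem supSeminorm_le_norm (K : Compacts Ω) (f : Ω →ᵇ ℝ) : supSeminorm K f ≤ ‖f‖ :=
  iSup_abs_le_norm _ f

/-- The compact-open topology `τ_c` on `C_b(Ω)`: the locally convex topology generated by the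
seminorms `p_K`, `K ⊆ Ω` compact. -/
@[reducible] noncomputable def tauc (Ω : Type*) [TopologicalSpace Ω] : TopologicalSpace (Ω →ᵇ ℝ) :=
  SeminormFamily.moduleFilterBasis
    (𝕜 := ℝ) (F := Ω →ᵇ ℝ) (fun K : Compacts Ω => supSeminorm K) |>.topology

/-- Parameters of the seminorms of the mixed topology: a sequence `(K_n)` of compact sets and a
null sequence `(a_n)` of nonnegative real numbers. -/
structure MixedIndex (Ω : Type*) [TopologicalSpace Ω] where
  K : ℕ → Compacts Ω
  a : ℕ → ℝ
  a_nonneg : ∀ n, 0 ≤ a n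
  a_tendsto : Tendsto a atTop (𝓝 0)

instance : Nonempty (MixedIndex Ω) :=
  ⟨⟨fun _ => ⊥, fun _ => 0, fun _ => le_rfl, tendsto_const_nhds⟩⟩

/-- The supremum defining the mixed seminorm is over a bounded set. -/
theorem bddAbove_mixed (i : MixedIndex Ω) (f : Ω →ᵇ ℝ) :
    BddAbove (range fun n => i.a n * supSeminorm (i.K n) f) := by
  obtain ⟨C, hC⟩ := i.a_tendsto.bddAbove_range
  refine ⟨C * ‖f‖, ?_⟩
  rintro _ ⟨n, rfl⟩
  exact mul_le_mul (hC ⟨n, rfl⟩) (supSeminorm_le_norm _ f) (apply_nonneg _ _)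
    ((i.a_nonneg n).trans (hC ⟨n, rfl⟩))

/-- The seminorm `f ↦ sup_n a_n p_{K_n}(f)` on `C_b(Ω)`. -/
noncomputable def mixedSeminorm (i : MixedIndex Ω) : Seminorm ℝ (Ω →ᵇ ℝ) :=
  Seminorm.of (fun f => ⨆ n, i.a n * supSeminorm (i.K n) f)
    (fun f g => Real.iSup_le
      (fun n => (mul_le_mul_of_nonneg_left (map_add_le_add _ f g) (i.a_nonneg n)).trans
        ((mul_add _ _ _).trans_le
          (add_le_add (le_ciSup (bddAbove_mixed i f) n) (le_ciSup (bddAbove_mixed i g) n))))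
      (add_nonneg
        (Real.iSup_nonneg fun n => mul_nonneg (i.a_nonneg n) (apply_nonneg _ _))
        (Real.iSup_nonneg fun n => mul_nonneg (i.a_nonneg n) (apply_nonneg _ _))))
    (fun c f => by
      simp only [map_smul_eq_mul, mul_left_comm _ ‖c‖]
      exact (Real.mul_iSup_of_nonneg (norm_nonneg c) _).symm)

/-- The mixed (strict) topology `β₀` on `C_b(Ω)`: the locally convex topology generated by the
seminorms `f ↦ sup_n a_n p_{K_n}(f)`, with `K_n ⊆ Ω` compact and `0 ≤ a_n → 0`. -/
@[reducible] noncomputable def beta0 (Ω : Type*) [TopologicalSpace Ω] : TopologicalSpace (Ω →ᵇ ℝ) :=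
  SeminormFamily.moduleFilterBasis
    (𝕜 := ℝ) (F := Ω →ᵇ ℝ) (fun i : MixedIndex Ω => mixedSeminorm i) |>.topology

/-- A sup-norm bounded sequence in `C_b(Ω)` that converges to `0` in `τ_c`. -/
def IsBoundedTaucNull (f : ℕ → Ω →ᵇ ℝ) : Prop :=
  (∃ C : ℝ, ∀ n, ‖f n‖ ≤ C) ∧ Tendsto f atTop (@nhds _ (tauc Ω) 0)

/-- `τ_c`-strong continuity: all orbits `t ↦ T(t)f` are `τ_c`-continuous on `[0, ∞)`. -/
def TaucStronglyContinuous (T : ℝ≥0 → (Ω →ᵇ ℝ) →L[ℝ] (Ω →ᵇ ℝ)) : Prop :=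
  ∀ f : Ω →ᵇ ℝ, @Continuous _ _ _ (tauc Ω) (fun t => T t f)

/-- The operator norms `‖T(t)‖` are bounded for `t` in any compact interval of `[0, ∞)`. -/
def LocallyNormBounded (T : ℝ≥0 → (Ω →ᵇ ℝ) →L[ℝ] (Ω →ᵇ ℝ)) : Prop :=
  ∀ a b : ℝ≥0, ∃ C : ℝ, ∀ t ∈ Icc a b, ‖T t‖ ≤ C

/-- Local `β₀`-equicontinuity: for every compact interval `[a, b]` of `[0, ∞)` the family of linear
operators `{T(t) : t ∈ [a, b]}` is equicontinuous from `(C_b(Ω), β₀)` to `(C_b(Ω), β₀)`. -/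
def LocallyBeta0Equicontinuous (T : ℝ≥0 → (Ω →ᵇ ℝ) →L[ℝ] (Ω →ᵇ ℝ)) : Prop :=
  ∀ a b : ℝ≥0, ∀ V ∈ @nhds _ (beta0 Ω) 0, ∃ U ∈ @nhds _ (beta0 Ω) 0,
    ∀ t ∈ Icc a b, ∀ f ∈ U, T t f ∈ V

/-- Local `τ_c`-bi-equicontinuity: for every sup-norm bounded `τ_c`-null sequence `(f_n)`,
`T(t) f_n → 0` in `τ_c`, uniformly for `t` in compact intervals of `[0, ∞)`. -/
def LocallyTaucBiEquicontinuous (T : ℝ≥0 → (Ω →ᵇ ℝ) →L[ℝ] (Ω →ᵇ ℝ)) : Prop :=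
  ∀ f : ℕ → Ω →ᵇ ℝ, IsBoundedTaucNull f → ∀ a b : ℝ≥0, ∀ V ∈ @nhds _ (tauc Ω) 0,
    ∀ᶠ n in atTop, ∀ t ∈ Icc a b, T t (f n) ∈ V

end CbSemigroup

/-! For fixed `[a, b]` and `K`, view `f ↦ (T(t)f)(x)` as functionals `Φ_s` indexed by `s = (t, x)`
in the compact space `[a, b] × K`. They depend continuously on `s` for each `f`, are uniformly norm
bounded, and each sends bounded `τ_c`-null sequences to null sequences. The estimate says that such
a family is uniformly tight.

Tightness along one continuous `u` (`exists_forall_abs_le_of_eq_zero`) is a gliding hump argument.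
If it fails, there are disjoint bumps `G_j`, moving to infinity along `u`, and indices `s_j` with
`|Φ_{s_j}(G_j)| > ε`. Sums of subfamilies of bumps give a separately continuous function on (Cantor
space) × (compact space), in which switching coordinate `j` changes the value by `Φ_s(G_j)`. Baire's
theorem (`exists_abs_update_sub_le`) makes this change at most `ε` at some `s_j`, a contradiction.

Both classes of spaces carry functions `u_k` for which every intersection `⋂ {u_k ≤ n_k}` is
compact. Adding up errors `ε/2^(k+1)` turns tightness along each `u_k` into tightness on one compact
set (`exists_compact_forall_abs_le`). Bi-equicontinuity is then immediate; `β₀`-equicontinuity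
follows by dyadic truncation (`exists_forall_le_mul_mixedSeminorm`). -/

namespace CbSemigroup

/-! ### Topologies generated by seminorms -/

section SeminormTopology

variable {E ι α : Type*} [AddCommGroup E] [Module ℝ E] (p : SeminormFamily ℝ E ι)

theorem tendsto_nhds_seminormFamily_iff {l : Filter α} {f : α → E} {x : E} :
    Tendsto f l (@nhds _ p.moduleFilterBasis.topology x) ↔
      ∀ i, ∀ ε : ℝ, 0 < ε → ∀ᶠ a in l, p i (f a - x) < ε := by
  let := p.moduleFilterBasis.topology
  exact (WithSeminorms.mk rfl : WithSeminorms p).tendsto_nhds f x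

theorem mem_nhds_zero_seminormFamily_iff {V : Set E} :
    V ∈ @nhds _ p.moduleFilterBasis.topology 0 ↔
      ∃ s : Finset ι, ∃ r : ℝ, 0 < r ∧ ∀ x, (∀ i ∈ s, p i x < r) → x ∈ V := by
  let := p.moduleFilterBasis.topology
  rw [(WithSeminorms.mk rfl : WithSeminorms p).mem_nhds_iff]
  refine exists_congr fun s => exists_congr fun r => and_congr_right fun hr => ?_
  refine ⟨fun h x hx => h ?_, fun h x hx => h x fun i hi => ?_⟩
  · rw [Seminorm.mem_ball_zero]
    exact Seminorm.finset_sup_apply_lt hr hx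
  · rw [Seminorm.mem_ball_zero] at hx
    exact (Seminorm.le_def.1 (Finset.le_sup (f := p) hi) x).trans_lt hx

end SeminormTopology

/-! ### Separate continuity and Baire category on the Cantor space -/

section SeparatelyContinuous

variable {S : Type*} [TopologicalSpace S] [CompactSpace S]

/-- A sequence in a compact space has a subsequence along which all members of a separately
continuous family parametrized by the Cantor space converge. -/
theorem exists_subseq_tendsto_of_separately_continuous {F : (ℕ → Bool) → S → ℝ}
    (hF : ∀ c, Continuous (F c)) (hF' : ∀ s, Continuous fun c => F c s) (s : ℕ → S) :
    ∃ (φ : ℕ → ℕ) (s₀ : S), StrictMono φ ∧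
      ∀ c, Tendsto (fun j => F c (s (φ j))) atTop (𝓝 (F c s₀)) := by
  let d : ℕ → (ℕ → Bool) := denseSeq _
  -- `S` need not be sequentially compact, but its image under countably many functions in `ℕ → ℝ`
  -- is.
  let ψ : S → ℕ → ℝ := fun s k => F (d k) s
  have hψ : Continuous ψ := continuous_pi fun k => hF (d k)
  obtain ⟨_, ⟨s₀, rfl⟩, φ, hφ, hlim⟩ :=
    (isCompact_range hψ).isSeqCompact (fun n => mem_range_self (s n))
  refine ⟨φ, s₀, hφ, fun c => ?_⟩
  -- Along any ultrafilter the points converge to some `s'`; `F · s'` and `F · s₀` agree on a dense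
  -- set, hence everywhere, so the limit does not depend on the ultrafilter.
  rw [tendsto_iff_ultrafilter]
  intro g hg
  obtain ⟨s', -, hs'⟩ := isCompact_univ.ultrafilter_le_nhds (g.map (s ∘ φ)) (by simp)
  have hs' : Tendsto (s ∘ φ) g (𝓝 s') := hs'
  have hFs' : ∀ c, Tendsto (fun j => F c (s (φ j))) g (𝓝 (F c s')) := fun c =>
    ((hF c).tendsto s').comp hs'
  have hd : ∀ k, F (d k) s' = F (d k) s₀ := fun k =>
    tendsto_nhds_unique (hFs' (d k)) (((tendsto_pi_nhds.1 hlim) k).mono_left hg)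
  have heq : (fun c => F c s') = fun c => F c s₀ :=
    (denseRange_denseSeq (ℕ → Bool)).equalizer (hF' s') (hF' s₀) (funext hd)
  rw [← congrFun heq c]
  exact hFs' c

theorem tendsto_update_atTop (c : ℕ → Bool) (b : Bool) :
    Tendsto (fun n => Function.update c n b) atTop (𝓝 c) := by
  refine tendsto_pi_nhds.2 fun i => tendsto_nhds_of_eventually_eq ?_
  filter_upwards [eventually_gt_atTop i] with n hn
  exact Function.update_of_ne hn.ne _ _

/-- In a separately continuous family parametrized by the Cantor space, the dependence on the
`n`-th coordinate becomes uniformly small for a suitable choice of the remaining coordinates. -/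
theorem exists_abs_update_sub_le {F : (ℕ → Bool) → S → ℝ}
    (hF : ∀ c, Continuous (F c)) (hF' : ∀ s, Continuous fun c => F c s) (s : ℕ → S)
    {ε : ℝ} (hε : 0 < ε) :
    ∃ n c, |F (Function.update c n true) (s n) - F (Function.update c n false) (s n)| ≤ ε := by
  obtain ⟨φ, s₀, hφ, hlim⟩ := exists_subseq_tendsto_of_separately_continuous hF hF' s
  -- Baire: some `A N` has an interior point `c`. Switching a far coordinate of `c` stays in `A N`,
  -- so values at `s (φ j)` can be compared with values at `s₀`.
  let A : ℕ → Set (ℕ → Bool) := fun N => {c | ∀ j ≥ N, |F c (s (φ j)) - F c s₀| ≤ ε / 3}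
  have hA : ∀ N, IsClosed (A N) := fun N => by
    simp only [A, ofPred_forall]
    exact isClosed_iInter fun j => isClosed_iInter fun _ =>
      isClosed_le (((hF' _).sub (hF' _)).abs) continuous_const
  have hU : ⋃ N, A N = univ := by
    refine eq_univ_of_forall fun c => mem_iUnion.2 ?_
    obtain ⟨N, hN⟩ := Metric.tendsto_atTop.1 (hlim c) (ε / 3) (by positivity)
    exact ⟨N, fun j hj => by simpa [Real.dist_eq] using (hN j hj).le⟩
  obtain ⟨N, c, hc⟩ := nonempty_interior_of_iUnion_of_closed hA hU
  have hmem : ∀ b, ∀ᶠ n in atTop, Function.update c n b ∈ A N := fun b =>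
    (tendsto_update_atTop c b).eventually
      ((mem_interior_iff_mem_nhds.1 hc))
  have hsub : Tendsto (fun n => F (Function.update c n true) s₀ - F (Function.update c n false) s₀)
      atTop (𝓝 0) := by
    simpa using (((hF' s₀).tendsto c).comp (tendsto_update_atTop c true)).sub
      (((hF' s₀).tendsto c).comp (tendsto_update_atTop c false))
  have hsmall := Metric.tendsto_nhds.1 hsub (ε / 3) (by positivity)
  obtain ⟨j, hj, h1, h2, h3⟩ := ((eventually_ge_atTop N).and (hφ.tendsto_atTop.eventually
    ((hmem true).and ((hmem false).and hsmall)))).exists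
  refine ⟨φ j, c, ?_⟩
  have h1 := abs_le.1 (h1 j hj)
  have h2 := abs_le.1 (h2 j hj)
  rw [Real.dist_eq, sub_zero] at h3
  have h3 := abs_lt.1 h3
  exact abs_le.2 ⟨by linarith, by linarith⟩

end SeparatelyContinuous

/-! ### Cutoffs, truncations and sums of disjoint bumps -/

section Auxiliary

variable {Ω : Type*} [TopologicalSpace Ω]

theorem supSeminorm_le_iff {K : Compacts Ω} {f : Ω →ᵇ ℝ} {r : ℝ} (hr : 0 ≤ r) :
    supSeminorm K f ≤ r ↔ ∀ x ∈ K, |f x| ≤ r :=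
  ⟨fun h x hx => (le_ciSup (bddAbove_abs (K : Set Ω) f) ⟨x, hx⟩).trans h,
    fun h => Real.iSup_le (fun x => h x x.2) hr⟩

theorem abs_apply_le_supSeminorm {K : Compacts Ω} (f : Ω →ᵇ ℝ) {x : Ω} (hx : x ∈ K) :
    |f x| ≤ supSeminorm K f :=
  (supSeminorm_le_iff (apply_nonneg _ _)).1 le_rfl x hx

theorem isBoundedTaucNull_of_eventually_eq_zero {f : ℕ → Ω →ᵇ ℝ} {C : ℝ} (hC : ∀ n, ‖f n‖ ≤ C)
    (h : ∀ L : Set Ω, IsCompact L → ∀ᶠ n in atTop, ∀ x ∈ L, f n x = 0) : IsBoundedTaucNull f := by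
  refine ⟨⟨C, hC⟩, (tendsto_nhds_seminormFamily_iff _).2 fun K ε hε => ?_⟩
  filter_upwards [h K K.isCompact] with n hn
  refine lt_of_le_of_lt ((supSeminorm_le_iff le_rfl).2 fun x hx => ?_) hε
  simp [hn x hx]

/-- A cutoff function that is `1` where `u ≤ n` and `0` where `u ≥ n + 1`. -/
noncomputable def cutoff (u : C(Ω, ℝ)) (n : ℕ) : Ω →ᵇ ℝ :=
  BoundedContinuousFunction.ofNormedAddCommGroup (fun x => max 0 (min 1 (n + 1 - u x)))
    (by fun_prop) 1 (fun x => by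
      rw [Real.norm_eq_abs, abs_of_nonneg (le_max_left _ _)]
      exact max_le zero_le_one (min_le_left _ _))

theorem cutoff_apply (u : C(Ω, ℝ)) (n : ℕ) (x : Ω) :
    cutoff u n x = max 0 (min 1 (n + 1 - u x)) := rfl

theorem cutoff_nonneg (u : C(Ω, ℝ)) (n : ℕ) (x : Ω) : 0 ≤ cutoff u n x := le_max_left _ _

theorem cutoff_le_one (u : C(Ω, ℝ)) (n : ℕ) (x : Ω) : cutoff u n x ≤ 1 :=
  max_le zero_le_one (min_le_left _ _)

theorem cutoff_eq_one {u : C(Ω, ℝ)} {n : ℕ} {x : Ω} (h : u x ≤ n) : cutoff u n x = 1 := by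
  rw [cutoff_apply, min_eq_left (by linarith), max_eq_right zero_le_one]

theorem cutoff_eq_zero {u : C(Ω, ℝ)} {n : ℕ} {x : Ω} (h : n + 1 ≤ u x) : cutoff u n x = 0 := by
  rw [cutoff_apply, max_eq_left ((min_le_right _ _).trans (by linarith))]

theorem norm_mul_le_of_abs_le_one {g f : Ω →ᵇ ℝ} (hg : ∀ x, |g x| ≤ 1) : ‖g * f‖ ≤ ‖f‖ := by
  refine (BoundedContinuousFunction.norm_le (norm_nonneg _)).2 fun x => ?_
  rw [BoundedContinuousFunction.coe_mul, Pi.mul_apply, norm_mul]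
  exact (mul_le_of_le_one_left (norm_nonneg _) (hg x)).trans (f.norm_coe_le_norm x)

theorem norm_cutoff_mul_le (u : C(Ω, ℝ)) (n : ℕ) (f : Ω →ᵇ ℝ) : ‖cutoff u n * f‖ ≤ ‖f‖ :=
  norm_mul_le_of_abs_le_one fun x => abs_le.2
    ⟨by linarith [cutoff_nonneg u n x], cutoff_le_one u n x⟩

/-- The truncation of a bounded continuous function to values in `[-B, B]`. -/
noncomputable def truncate (B : ℝ) (f : Ω →ᵇ ℝ) : Ω →ᵇ ℝ :=
  (f ⊓ BoundedContinuousFunction.const Ω B) ⊔ BoundedContinuousFunction.const Ω (-B)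

theorem truncate_apply (B : ℝ) (f : Ω →ᵇ ℝ) (x : Ω) :
    truncate B f x = max (min (f x) B) (-B) := rfl

theorem abs_truncate_le {B : ℝ} (hB : 0 ≤ B) (f : Ω →ᵇ ℝ) (x : Ω) : |truncate B f x| ≤ B :=
  abs_le.2 ⟨le_max_right _ _, max_le (min_le_right _ _) ((neg_nonpos.2 hB).trans hB)⟩

theorem norm_truncate_le {B : ℝ} (hB : 0 ≤ B) (f : Ω →ᵇ ℝ) : ‖truncate B f‖ ≤ B :=
  (BoundedContinuousFunction.norm_le hB).2 (abs_truncate_le hB f)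

theorem truncate_eq_self {B : ℝ} {f : Ω →ᵇ ℝ} {x : Ω} (h : |f x| ≤ B) : truncate B f x = f x := by
  rw [truncate_apply, min_eq_left (abs_le.1 h).2, max_eq_left (abs_le.1 h).1]

theorem abs_sub_truncate_le {B : ℝ} (hB : 0 ≤ B) (f : Ω →ᵇ ℝ) (x : Ω) :
    |f x - truncate B f x| ≤ |f x| := by
  rw [truncate_apply]
  rcases le_total (f x) B with h | h
  · rw [min_eq_left h]
    rcases le_total (f x) (-B) with h' | h'
    · rw [max_eq_right h', abs_of_nonpos (by linarith), abs_of_nonpos (by linarith)]; linarith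
    · rw [max_eq_left h']; simp
  · rw [min_eq_right h, max_eq_left (by linarith), abs_of_nonneg (by linarith),
      abs_of_nonneg (by linarith)]; linarith

/-- Sums of subfamilies of a locally finite family with disjoint supports. -/
theorem exists_sum_of_locallyFinite {G : ℕ → Ω →ᵇ ℝ} {C : ℝ} (hC : 0 ≤ C) (hG : ∀ j, ‖G j‖ ≤ C)
    (hdisj : ∀ i j x, G i x ≠ 0 → G j x ≠ 0 → i = j)
    (hfin : LocallyFinite fun j => Function.support (G j)) :
    ∃ B : (ℕ → Bool) → Ω →ᵇ ℝ, (∀ c, ‖B c‖ ≤ C) ∧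
      (∀ c x j, G j x ≠ 0 → B c x = if c j then G j x else 0) ∧
      ∀ c x, (∀ j, G j x = 0) → B c x = 0 := by
  let b : (ℕ → Bool) → Ω → ℝ := fun c x => ∑ᶠ j, if c j then G j x else 0
  have hb1 : ∀ c x j, G j x ≠ 0 → b c x = if c j then G j x else 0 := fun c x j hj =>
    finsum_eq_single _ j fun i hi => by
      have : G i x = 0 := by
        by_contra h
        exact hi (hdisj i j x h hj)
      simp [this]
  have hb2 : ∀ c x, (∀ j, G j x = 0) → b c x = 0 := fun c x h => by simp [b, h]
  have hbn : ∀ c x, ‖b c x‖ ≤ C := fun c x => by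
    by_cases h : ∃ j, G j x ≠ 0
    · obtain ⟨j, hj⟩ := h
      rw [hb1 c x j hj]
      split_ifs
      · exact ((G j).norm_coe_le_norm x).trans (hG j)
      · simpa using hC
    · push Not at h
      simpa [hb2 c x h] using hC
  have hbc : ∀ c, Continuous (b c) := fun c => by
    refine continuous_finsum (fun j => ?_) (hfin.subset fun j x hx => ?_)
    · split_ifs
      · exact (G j).continuous
      · exact continuous_const
    · intro h
      exact hx (by simp [h])
  exact ⟨fun c => BoundedContinuousFunction.ofNormedAddCommGroup (b c) (hbc c) C (hbn c),
    fun c => BoundedContinuousFunction.norm_ofNormedAddCommGroup_le _ hC _, hb1, hb2⟩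

end Auxiliary

/-! ### Uniform tightness by a gliding hump -/

section UniformTightness

variable {Ω S : Type*} [TopologicalSpace Ω] [TopologicalSpace S] [CompactSpace S]
  {Φ : S → (Ω →ᵇ ℝ) →ₗ[ℝ] ℝ}

/-- A weakly continuous family of sequentially continuous functionals over a compact space is
uniformly small on functions that vanish on a large sublevel set of a given continuous function. -/
theorem exists_forall_abs_le_of_eq_zero (hΦ : ∀ f, Continuous fun s => Φ s f)
    (hnull : ∀ s f, IsBoundedTaucNull f → Tendsto (fun n => Φ s (f n)) atTop (𝓝 0))
    (u : C(Ω, ℝ)) {ε : ℝ} (hε : 0 < ε) :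
    ∃ n : ℕ, ∀ s f, ‖f‖ ≤ 1 → (∀ x, u x ≤ n → f x = 0) → |Φ s f| ≤ ε := by
  have hu : ∀ L : Set Ω, IsCompact L → ∃ R : ℕ, ∀ x ∈ L, u x ≤ R := fun L hL => by
    obtain ⟨R, hR⟩ := hL.bddAbove_image u.continuous.continuousOn
    obtain ⟨n, hn⟩ := exists_nat_ge R
    exact ⟨n, fun x hx => (hR (mem_image_of_mem _ hx)).trans hn⟩
  by_contra! h
  choose s f hf hf0 hlt using h
  -- Since `u` is bounded on compact sets, cutting `f n` off far out changes the functional by a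
  -- null sequence; the strict inequality survives.
  have hm : ∀ n, ∃ m ≥ n, ε < |Φ (s n) (cutoff u m * f n)| := fun n => by
    have hnl : IsBoundedTaucNull fun m => f n - cutoff u m * f n := by
      refine isBoundedTaucNull_of_eventually_eq_zero (C := 1 + 1) (fun m => ?_) fun L hL => ?_
      · exact (norm_sub_le _ _).trans
          (add_le_add (hf n) ((norm_cutoff_mul_le _ _ _).trans (hf n)))
      · obtain ⟨R, hR⟩ := hu L hL
        filter_upwards [eventually_ge_atTop R] with m hmR x hx
        have : cutoff u m x = 1 := cutoff_eq_one ((hR x hx).trans (by exact_mod_cast hmR))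
        simp [this]
    have hlim : Tendsto (fun m => |Φ (s n) (cutoff u m * f n)|) atTop (𝓝 |Φ (s n) (f n)|) := by
      have := (tendsto_const_nhds (x := Φ (s n) (f n))).sub (hnull (s n) _ hnl)
      simpa using this.abs
    obtain ⟨m, h1, h2⟩ := ((eventually_ge_atTop n).and
      (hlim.eventually (lt_mem_nhds (hlt n)))).exists
    exact ⟨m, h1, h2⟩
  choose m hmn hm using hm
  -- The cutoff at level `m` vanishes only from `m + 1` on, so this recursion places bump `j` in `N
  -- j < u < N (j + 1)`.
  obtain ⟨N, hNs⟩ : ∃ N : ℕ → ℕ, ∀ j, N (j + 1) = m (N j) + 1 :=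
    ⟨fun j => Nat.rec 0 (fun _ k => m k + 1) j, fun _ => rfl⟩
  have hN : StrictMono N := strictMono_nat_of_lt_succ fun j => by
    rw [hNs]
    exact Nat.lt_succ_of_le (hmn _)
  let G : ℕ → Ω →ᵇ ℝ := fun j => cutoff u (m (N j)) * f (N j)
  have hGlow : ∀ (j : ℕ) (x : Ω), G j x ≠ 0 → ((N j : ℕ) : ℝ) < u x := fun j x hx => by
    by_contra hle
    exact hx (by simp [G, hf0 (N j) x (not_lt.1 hle)])
  have hGup : ∀ (j : ℕ) (x : Ω), G j x ≠ 0 → u x < N (j + 1) := fun j x hx => by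
    by_contra hle
    refine hx ?_
    have : cutoff u (m (N j)) x = 0 := by
      refine cutoff_eq_zero ?_
      have := not_lt.1 hle
      rw [hNs] at this
      exact_mod_cast this
    simp [G, this]
  have hGnorm : ∀ j, ‖G j‖ ≤ 1 := fun j => (norm_cutoff_mul_le _ _ _).trans (hf _)
  have hlt_of : ∀ i j x, G i x ≠ 0 → G j x ≠ 0 → i < j + 1 := fun i j x hi hj =>
    hN.lt_iff_lt.1 (by exact_mod_cast (hGlow i x hi).trans (hGup j x hj))
  have hdisj : ∀ i j x, G i x ≠ 0 → G j x ≠ 0 → i = j := fun i j x hi hj =>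
    le_antisymm (Nat.lt_succ_iff.1 (hlt_of i j x hi hj)) (Nat.lt_succ_iff.1 (hlt_of j i x hj hi))
  have hidx : ∀ (R : ℕ) j x, u x < R → G j x ≠ 0 → j < R := fun R j x hR hj => by
    have h1 : N j < R := by exact_mod_cast (hGlow j x hj).trans hR
    exact (hN.le_apply).trans_lt h1
  have hfin : LocallyFinite fun j => Function.support (G j) := fun x => by
    obtain ⟨R, hR⟩ := exists_nat_gt (u x)
    refine ⟨{y | u y < R}, (isOpen_lt u.continuous continuous_const).mem_nhds hR,
      (finite_lt_nat R).subset ?_⟩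
    rintro j ⟨y, hy, hyR⟩
    exact hidx R j y hyR hy
  obtain ⟨B, hBn, hB1, hB0⟩ := exists_sum_of_locallyFinite zero_le_one hGnorm hdisj hfin
  have hupd : ∀ c j, B (Function.update c j true) - B (Function.update c j false) = G j := by
    intro c j
    ext x
    rw [BoundedContinuousFunction.coe_sub, Pi.sub_apply]
    by_cases hx : ∃ i, G i x ≠ 0
    · obtain ⟨i, hi⟩ := hx
      rw [hB1 _ x i hi, hB1 _ x i hi]
      by_cases hij : i = j
      · subst hij
        simp
      · have : G j x = 0 := by
          by_contra h
          exact hij (hdisj i j x hi h)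
        simp [Function.update_of_ne hij, this]
    · push Not at hx
      rw [hB0 _ x hx, hB0 _ x hx, hx j, sub_zero]
  -- Only finitely many bumps meet a given compact set, so convergence in the Cantor space makes the
  -- sums eventually equal there.
  have hBcont : ∀ t, Continuous fun c => Φ t (B c) := fun t => by
    refine continuous_iff_seqContinuous.2 fun c c₀ hc => ?_
    have hnl : IsBoundedTaucNull fun k => B (c k) - B c₀ := by
      refine isBoundedTaucNull_of_eventually_eq_zero (C := 1 + 1) (fun k => ?_) fun L hL => ?_
      · exact (norm_sub_le _ _).trans (add_le_add (hBn _) (hBn _))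
      · obtain ⟨R, hR⟩ := hu L hL
        have hev : ∀ᶠ k in atTop, ∀ i ∈ Finset.range (R + 1), c k i = c₀ i :=
          (Finset.eventually_all _).2 fun i _ =>
            ((tendsto_pi_nhds.1 hc i).eventually (mem_nhds_discrete.2 rfl)).mono fun _ => Eq.symm
        filter_upwards [hev] with k hk x hx
        rw [BoundedContinuousFunction.coe_sub, Pi.sub_apply]
        by_cases hxG : ∃ i, G i x ≠ 0
        · obtain ⟨i, hi⟩ := hxG
          have : i < R + 1 :=
            hidx _ i x ((hR x hx).trans_lt (by exact_mod_cast Nat.lt_succ_self R)) hi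
          rw [hB1 _ x i hi, hB1 _ x i hi, hk i (Finset.mem_range.2 this), sub_self]
        · push Not at hxG
          rw [hB0 _ x hxG, hB0 _ x hxG, sub_zero]
    simpa [Function.comp_def] using (hnull t _ hnl).add_const (Φ t (B c₀))
  obtain ⟨j, c, hjc⟩ := exists_abs_update_sub_le (F := fun c t => Φ t (B c))
    (fun c => hΦ (B c)) hBcont (fun j => s (N j)) hε
  simp only [← map_sub, hupd] at hjc
  exact absurd (hm (N j)) (not_lt.2 hjc)

/-- Uniform tightness of a weakly continuous family of sequentially continuous functionals over a
compact space, when suitable intersections of sublevel sets are compact. -/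
theorem exists_compact_forall_abs_le (hΦ : ∀ f, Continuous fun s => Φ s f)
    (hnull : ∀ s f, IsBoundedTaucNull f → Tendsto (fun n => Φ s (f n)) atTop (𝓝 0))
    {C : ℝ} (hC : 0 ≤ C) (hbdd : ∀ s f, |Φ s f| ≤ C * ‖f‖) (u : ℕ → C(Ω, ℝ))
    (hu : ∀ n : ℕ → ℕ, IsCompact (⋂ k, {x | u k x ≤ n k})) {ε : ℝ} (hε : 0 < ε) :
    ∃ K : Compacts Ω, ∀ s f, |Φ s f| ≤ C * supSeminorm K f + ε * ‖f‖ := by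
  choose n hn using fun k : ℕ =>
    exists_forall_abs_le_of_eq_zero hΦ hnull (u k) (ε := ε / 2 / 2 ^ k) (by positivity)
  have hn' : ∀ k s f, (∀ x, u k x ≤ n k → f x = 0) → |Φ s f| ≤ ε / 2 / 2 ^ k * ‖f‖ := by
    intro k s f hf
    rcases (norm_nonneg f).eq_or_lt' with h0 | h0
    · have := hbdd s f
      rw [h0, mul_zero] at this ⊢
      exact this
    · have := hn k s (‖f‖⁻¹ • f)
        (by rw [norm_smul, norm_inv, norm_norm, inv_mul_cancel₀ h0.ne'])
        (fun x hx => by simp [hf x hx])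
      rw [map_smul, smul_eq_mul, abs_mul, abs_of_pos (inv_pos.2 h0), inv_mul_le_iff₀ h0] at this
      linarith
  -- Levels `n k + 1`, not `n k`: off this set some factor `cutoff (u k) (n k)` vanishes.
  refine ⟨⟨⋂ k, {x | u k x ≤ (n k + 1 : ℕ)}, hu fun k => n k + 1⟩, fun s f => ?_⟩
  set K : Compacts Ω := ⟨⋂ k, {x | u k x ≤ (n k + 1 : ℕ)}, hu fun k => n k + 1⟩ with hK
  let P : ℕ → Ω →ᵇ ℝ := fun m => ∏ k ∈ Finset.range m, cutoff (u k) (n k)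
  have hPapp : ∀ m x, P m x = ∏ k ∈ Finset.range m, cutoff (u k) (n k) x := fun m x => by
    simp [P]
  have hP1 : ∀ m x, |P m x| ≤ 1 := fun m x => by
    rw [hPapp, Finset.abs_prod]
    exact Finset.prod_le_one (fun _ _ => abs_nonneg _) fun k _ => abs_le.2
      ⟨by linarith [cutoff_nonneg (u k) (n k) x], cutoff_le_one _ _ _⟩
  -- Telescoping: the `m`-th new factor only removes a function vanishing on `{u m ≤ n m}`.
  have hPf : ∀ m, |Φ s (f - P m * f)| ≤ (∑ k ∈ Finset.range m, ε / 2 / 2 ^ k) * ‖f‖ := by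
    intro m
    induction m with
    | zero => simp [P]
    | succ m ih =>
      have hsplit : f - P (m + 1) * f =
          (f - P m * f) + (P m * f - cutoff (u m) (n m) * (P m * f)) := by
        simp only [P, Finset.prod_range_succ]
        ring
      have hlast : |Φ s (P m * f - cutoff (u m) (n m) * (P m * f))| ≤ ε / 2 / 2 ^ m * ‖f‖ := by
        refine (hn' m s _ fun x hx => ?_).trans
          (mul_le_mul_of_nonneg_left ?_ (by positivity))
        · simp [cutoff_eq_one hx]
        · have : P m * f - cutoff (u m) (n m) * (P m * f) =
              (1 - cutoff (u m) (n m)) * (P m * f) := by ring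
          rw [this]
          refine (norm_mul_le_of_abs_le_one fun x => ?_).trans (norm_mul_le_of_abs_le_one (hP1 m))
          have h1 := cutoff_nonneg (u m) (n m) x
          have h2 := cutoff_le_one (u m) (n m) x
          rw [BoundedContinuousFunction.coe_sub, BoundedContinuousFunction.coe_one, Pi.sub_apply,
            Pi.one_apply, abs_le]
          constructor <;> linarith
      rw [hsplit, map_add, Finset.sum_range_succ, add_mul]
      exact (abs_add_le _ _).trans (add_le_add ih hlast)
  have hgeom : ∀ m, ∑ k ∈ Finset.range m, ε / 2 / 2 ^ k ≤ ε := fun m => by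
    have h : Summable fun k : ℕ => ε / 2 / 2 ^ k := summable_geometric_two' ε
    exact (h.sum_le_tsum _ fun k _ => by positivity).trans_eq (tsum_geometric_two' ε)
  -- The slack `η` makes `{|f| ≥ q}` disjoint from `K`. By compactness finitely many sublevel sets
  -- already exclude its trace on `L`, so `P m` eventually kills the part of `f` above the
  -- truncation there.
  have key : ∀ η : ℝ, 0 < η → |Φ s f| ≤ C * (supSeminorm K f + η) + ε * ‖f‖ := by
    intro η hη
    set q := supSeminorm K f + η with hq
    have hq0 : 0 ≤ q := add_nonneg (apply_nonneg _ _) hη.le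
    have hnl : IsBoundedTaucNull fun m => P m * (f - truncate q f) := by
      refine isBoundedTaucNull_of_eventually_eq_zero (C := ‖f‖) (fun m => ?_) fun L hL => ?_
      · refine (norm_mul_le_of_abs_le_one (hP1 m)).trans
          ((BoundedContinuousFunction.norm_le (norm_nonneg _)).2 fun x => ?_)
        exact (abs_sub_truncate_le hq0 f x).trans (f.norm_coe_le_norm x)
      · have hZ : IsCompact (L ∩ {x | q ≤ |f x|}) :=
          hL.inter_right (isClosed_le continuous_const f.continuous.abs)
        obtain ⟨t, ht⟩ := hZ.elim_finite_subfamily_closed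
          (fun k => {x | u k x ≤ (n k + 1 : ℕ)})
          (fun k => isClosed_le (u k).continuous continuous_const) (by
            refine eq_empty_of_forall_notMem fun x hx => ?_
            have h1 : |f x| ≤ supSeminorm K f := abs_apply_le_supSeminorm f hx.2
            have h2 : q ≤ |f x| := hx.1.2
            linarith)
        obtain ⟨m₀, hm₀⟩ := t.exists_nat_subset_range
        filter_upwards [eventually_ge_atTop m₀] with m hm x hx
        rw [BoundedContinuousFunction.coe_mul, Pi.mul_apply]
        rcases le_total (|f x|) q with h | h
        · simp [truncate_eq_self h]
        · have hx' : x ∉ ⋂ k ∈ t, {x | u k x ≤ (n k + 1 : ℕ)} := fun h' => by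
            have : x ∈ (∅ : Set Ω) := ht ▸ ⟨⟨hx, h⟩, h'⟩
            exact this
          simp only [mem_iInter, mem_ofPred_eq, not_forall, not_le] at hx'
          obtain ⟨k, hk, hkx⟩ := hx'
          have h0 : P m x = 0 := by
            rw [hPapp]
            refine Finset.prod_eq_zero
              (Finset.range_mono hm (hm₀ hk)) (cutoff_eq_zero ?_)
            exact_mod_cast hkx.le
          rw [h0, zero_mul]
    have hbound : ∀ m, |Φ s f| ≤ C * q + ε * ‖f‖ + |Φ s (P m * (f - truncate q f))| := fun m => by
      have hsplit : Φ s f =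
          Φ s (f - P m * f) + Φ s (P m * truncate q f) + Φ s (P m * (f - truncate q f)) := by
        rw [← map_add, ← map_add]
        congr 1
        ring
      have h1 : |Φ s (f - P m * f)| ≤ ε * ‖f‖ :=
        (hPf m).trans (mul_le_mul_of_nonneg_right (hgeom m) (norm_nonneg _))
      have h2 : |Φ s (P m * truncate q f)| ≤ C * q :=
        (hbdd s _).trans (mul_le_mul_of_nonneg_left
          ((norm_mul_le_of_abs_le_one (hP1 m)).trans (norm_truncate_le hq0 f)) hC)
      rw [hsplit]
      refine (abs_add_three _ _ _).trans ?_
      linarith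
    have hlim := ((hnull s _ hnl).abs.const_add (C * q + ε * ‖f‖))
    rw [abs_zero, add_zero] at hlim
    exact ge_of_tendsto' hlim hbound
  refine le_of_forall_pos_le_add fun δ hδ => ?_
  have hη := key (δ / (C + 1)) (by positivity)
  have : C * (δ / (C + 1)) ≤ δ := by
    rw [mul_div_assoc', div_le_iff₀ (by positivity)]
    nlinarith
  linarith

end UniformTightness

/-! ### Continuous functions with compact sublevel intersections -/

section Exhaustion

variable {Ω : Type*} [TopologicalSpace Ω]

/-- The admissible values at each point form a convex set, and the constant `m` is admissible on all
of `U m`; a partition of unity glues these constants. -/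
theorem exists_continuous_sublevel_subset [T2Space Ω] [ParacompactSpace Ω] {U : ℕ → Set Ω}
    (hmono : Monotone U) (hopen : ∀ n, IsOpen (U n)) (hcover : ∀ x, ∃ n, x ∈ U n) :
    ∃ u : C(Ω, ℝ), ∀ (n : ℕ) x, u x ≤ n → x ∈ U n := by
  refine (exists_continuous_forall_mem_convex_of_local_const
    (t := fun x => {c : ℝ | ∀ n : ℕ, c ≤ n → x ∈ U n}) (fun x => ?_) fun x => ?_).imp
    fun u hu n x => hu x n
  · refine Set.OrdConnected.convex ⟨fun a ha b _ c hc n hcn => ha n (hc.1.trans hcn)⟩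
  · obtain ⟨m, hm⟩ := hcover x
    refine ⟨m, ?_⟩
    filter_upwards [(hopen m).mem_nhds hm] with y hy n hmn
    exact hmono (by exact_mod_cast hmn) hy

/-- Sublevel sets of `u k` lie in finitely many balls of radius `1/(k+1)` about a dense sequence, so
the intersections are closed and totally bounded in a complete metric. -/
theorem exists_sublevel_compact_of_polishSpace [PolishSpace Ω] :
    ∃ u : ℕ → C(Ω, ℝ), ∀ n : ℕ → ℕ, IsCompact (⋂ k, {x | u k x ≤ n k}) := by
  rcases isEmpty_or_nonempty Ω with h | h
  · exact ⟨fun _ => 0, fun n => (toFinite _).isCompact⟩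
  let := upgradeIsCompletelyMetrizable Ω
  choose u hu using fun k : ℕ => exists_continuous_sublevel_subset
    (U := fun n => ⋃ i ∈ Iic n, Metric.ball (denseSeq Ω i) (1 / ((k : ℝ) + 1)))
    (fun m n hmn => biUnion_subset_biUnion_left (Iic_subset_Iic.2 hmn))
    (fun n => isOpen_biUnion fun _ _ => Metric.isOpen_ball)
    (fun x => by
      obtain ⟨i, hi⟩ := (denseRange_denseSeq Ω).exists_dist_lt x
        (show (0 : ℝ) < 1 / ((k : ℝ) + 1) by positivity)
      exact ⟨i, mem_biUnion (self_mem_Iic) hi⟩)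
  refine ⟨u, fun n => TotallyBounded.isCompact_of_isClosed ?_
    (isClosed_iInter fun k => isClosed_le (u k).continuous continuous_const)⟩
  refine Metric.totallyBounded_iff.2 fun ε hε => ?_
  obtain ⟨k, hk⟩ := exists_nat_one_div_lt hε
  refine ⟨denseSeq Ω '' Iic (n k), (finite_Iic _).image _, fun x hx => ?_⟩
  have := hu k (n k) x (mem_iInter.1 hx k)
  rw [biUnion_image]
  exact biUnion_mono subset_rfl (fun i _ => Metric.ball_subset_ball hk.le) this

theorem exists_sublevel_compact_of_sigmaCompact [T2Space Ω] [LocallyCompactSpace Ω]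
    [SigmaCompactSpace Ω] :
    ∃ u : ℕ → C(Ω, ℝ), ∀ n : ℕ → ℕ, IsCompact (⋂ k, {x | u k x ≤ n k}) := by
  let K := CompactExhaustion.choice Ω
  obtain ⟨u, hu⟩ := exists_continuous_sublevel_subset (U := fun n => interior (K (n + 1)))
    (fun m n hmn => interior_mono (K.subset (by lia))) (fun n => isOpen_interior)
    (fun x => (K.exists_mem x).imp fun n hn => K.subset_interior_succ n hn)
  refine ⟨fun _ => u, fun n => (K.isCompact (n 0 + 1)).of_isClosed_subset
    (isClosed_iInter fun k => isClosed_le u.continuous continuous_const) fun x hx => ?_⟩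
  exact interior_subset (hu (n 0) x (mem_iInter.1 hx 0))

end Exhaustion

/-! ### Domination by a single mixed seminorm -/

section MixedBound

variable {Ω : Type*} [TopologicalSpace Ω]

theorem mul_supSeminorm_le_mixedSeminorm (i : MixedIndex Ω) (n : ℕ) (f : Ω →ᵇ ℝ) :
    i.a n * supSeminorm (i.K n) f ≤ mixedSeminorm i f :=
  le_ciSup (bddAbove_mixed i f) n

/-- A family of seminorms that is bounded, up to small multiples of the norm, by multiples of
`p_K`, `K` compact, is bounded by a multiple of a single mixed seminorm. -/
theorem exists_forall_le_mul_mixedSeminorm {ι : Type*} (p : ι → Seminorm ℝ (Ω →ᵇ ℝ))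
    (hp : ∀ ε : ℝ, 0 < ε → ∃ (M : ℝ) (K : Compacts Ω), 0 < M ∧
      ∀ i f, p i f ≤ M * supSeminorm K f + ε * ‖f‖) :
    ∃ (D : ℝ) (j : MixedIndex Ω), 0 < D ∧ ∀ i f, p i f ≤ D * mixedSeminorm j f := by
  obtain ⟨M₁, K₁, hM₁, h₁⟩ := hp 1 one_pos
  -- The error `4^-(m+1)` beats the size `2^(m+1) r` of the `m`-th dyadic slice of `f`, leaving a
  -- summable `2^-(m+1) r`.
  choose M L hM hL using fun m : ℕ => hp ((1 / 4) ^ (m + 1)) (by positivity)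
  let j : MixedIndex Ω :=
    { K := L
      a := fun m => (1 / 2) ^ m
      a_nonneg := fun m => by positivity
      a_tendsto := tendsto_pow_atTop_nhds_zero_of_lt_one (by norm_num) (by norm_num) }
  -- `M₁ + 1` bounds the contribution of the lowest truncation, the last `1` that of all slices.
  refine ⟨M₁ + 1 + 1, j, by positivity, ?_⟩
  have hbase : ∀ i (f : Ω →ᵇ ℝ), p i f ≤ (M₁ + 1) * ‖f‖ := fun i f => by
    have := mul_le_mul_of_nonneg_left (supSeminorm_le_norm K₁ f) hM₁.le
    linarith [h₁ i f]
  -- the estimate for functions in a multiple of the unit ball of the mixed seminorm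
  have hball : ∀ i (f : Ω →ᵇ ℝ) (r : ℝ), 0 < r → mixedSeminorm j f ≤ r →
      p i f ≤ (M₁ + 1 + 1) * r := by
    intro i f r hr hf
    have hfL : ∀ m, ∀ x ∈ L m, |f x| ≤ 2 ^ m * r := fun m x hx => by
      have h1 : (1 / 2 : ℝ) ^ m * |f x| ≤ r :=
        (mul_le_mul_of_nonneg_left (abs_apply_le_supSeminorm f hx) (by positivity)).trans
          ((mul_supSeminorm_le_mixedSeminorm j m f).trans hf)
      have h2 : (2 : ℝ) ^ m * (1 / 2) ^ m = 1 := by rw [← mul_pow]; norm_num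
      calc |f x| = 2 ^ m * ((1 / 2) ^ m * |f x|) := by rw [← mul_assoc, h2, one_mul]
        _ ≤ 2 ^ m * r := mul_le_mul_of_nonneg_left h1 (by positivity)
    let t : ℕ → Ω →ᵇ ℝ := fun m => truncate (2 ^ m * r) f
    have hstep : ∀ m, p i (t (m + 1) - t m) ≤ (1 / 2) ^ (m + 1) * r := fun m => by
      have hle : (2 : ℝ) ^ m * r ≤ 2 ^ (m + 1) * r :=
        mul_le_mul_of_nonneg_right (pow_le_pow_right₀ (by norm_num) m.le_succ) hr.le
      -- On `L m` both truncations leave `f` unchanged, so only the error term contributes.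
      have hzero : supSeminorm (L m) (t (m + 1) - t m) = 0 := by
        refine le_antisymm ((supSeminorm_le_iff le_rfl).2 fun x hx => ?_) (apply_nonneg _ _)
        rw [BoundedContinuousFunction.coe_sub, Pi.sub_apply, truncate_eq_self (hfL m x hx),
          truncate_eq_self ((hfL m x hx).trans hle), sub_self, abs_zero]
      have hnorm : ‖t (m + 1) - t m‖ ≤ 2 ^ (m + 1) * r := by
        refine (BoundedContinuousFunction.norm_le (by positivity)).2 fun x => ?_
        have hcomp : t m = truncate (2 ^ m * r) (t (m + 1)) := by
          ext y
          simp only [t, truncate_apply]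
          have h0 : 0 ≤ (2 : ℝ) ^ m * r := by positivity
          rcases le_total (f y) (2 ^ m * r) with h | h
          · rcases le_total (f y) (-(2 ^ m * r)) with h' | h'
            · rw [min_eq_left h, max_eq_right h', max_eq_right]
              exact (min_le_left _ _).trans
                (max_le ((min_le_left _ _).trans h') (neg_le_neg hle))
            · rw [min_eq_left h, max_eq_left h', min_eq_left (h.trans hle),
                max_eq_left ((neg_le_neg hle).trans h'), min_eq_left h, max_eq_left h']
          · rw [min_eq_right h, min_eq_right (le_max_of_le_left (le_min h hle))]
        rw [hcomp]
        exact (abs_sub_truncate_le (by positivity) _ x).trans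
          (abs_truncate_le (by positivity) f x)
      have h := hL m i (t (m + 1) - t m)
      rw [hzero, mul_zero, zero_add] at h
      refine h.trans ((mul_le_mul_of_nonneg_left hnorm (by positivity)).trans_eq ?_)
      rw [← mul_assoc, ← mul_pow]
      norm_num
    have hsum : ∀ m, p i (t m) ≤ (M₁ + 1) * r + (1 - (1 / 2) ^ m) * r := fun m => by
      induction m with
      | zero =>
        have h := (hbase i (t 0)).trans (mul_le_mul_of_nonneg_left
          (norm_truncate_le (by positivity) f) (by positivity))
        simpa using h
      | succ m ih =>
        have h := map_add_le_add (p i) (t m) (t (m + 1) - t m)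
        rw [add_sub_cancel] at h
        refine h.trans ((add_le_add ih (hstep m)).trans_eq ?_)
        ring
    obtain ⟨m, hm⟩ := pow_unbounded_of_one_lt (‖f‖ / r) (one_lt_two (α := ℝ))
    have htm : t m = f := by
      ext x
      exact truncate_eq_self ((f.norm_coe_le_norm x).trans ((div_lt_iff₀ hr).1 hm).le)
    have h := hsum m
    rw [htm] at h
    have : 0 ≤ (1 / 2 : ℝ) ^ m * r := by positivity
    linarith
  intro i f
  refine le_of_forall_pos_le_add fun δ hδ => ?_
  have h := hball i f (mixedSeminorm j f + δ / (M₁ + 1 + 1))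
    (add_pos_of_nonneg_of_pos (apply_nonneg _ _) (by positivity))
    (le_add_of_nonneg_right (by positivity))
  rwa [mul_add, mul_div_cancel₀ _ (by positivity)] at h

end MixedBound

/-! ### From functionals to operator families -/

section OperatorFamilies

variable {Ω : Type*} [TopologicalSpace Ω] {T : ℝ≥0 → (Ω →ᵇ ℝ) →L[ℝ] (Ω →ᵇ ℝ)}

/-- `τ_c`-continuity in `t` is uniform in `x ∈ K`, which upgrades separate to joint continuity. -/
theorem TaucStronglyContinuous.continuous_uncurry (hT : TaucStronglyContinuous T)
    (f : Ω →ᵇ ℝ) (I : Set ℝ≥0) (K : Compacts Ω) :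
    Continuous fun s : I × (K : Set Ω) => T s.1 f s.2 := by
  refine continuous_iff_continuousAt.2 fun ⟨t₀, x₀⟩ => Metric.tendsto_nhds.2 fun ε hε => ?_
  have h1 := (tendsto_nhds_seminormFamily_iff _).1
    ((@continuous_iff_continuousAt _ _ _ (tauc Ω) _).1 (hT f) t₀) K (ε / 2) (by positivity)
  have h1 := ((continuous_subtype_val.comp continuous_fst).tendsto
    ((t₀, x₀) : I × (K : Set Ω))).eventually h1
  have h2 := Metric.tendsto_nhds.1 (((T t₀ f).continuous.comp
    (continuous_subtype_val.comp continuous_snd)).tendsto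
    ((t₀, x₀) : I × (K : Set Ω))) (ε / 2) (by positivity)
  filter_upwards [h1, h2] with s h1 h2
  have h3 := (abs_apply_le_supSeminorm (T s.1 f - T t₀ f) s.2.2).trans_lt h1
  rw [Real.dist_eq] at h2 ⊢
  calc |T s.1 f s.2 - T t₀ f x₀|
      = |(T s.1 f - T t₀ f) s.2 + (T t₀ f s.2 - T t₀ f x₀)| := by simp
    _ ≤ _ := abs_add_le _ _
    _ < ε / 2 + ε / 2 := add_lt_add h3 h2
    _ = ε := add_halves ε

theorem exists_forall_supSeminorm_le (hT : TaucStronglyContinuous T) (hbdd : LocallyNormBounded T)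
    (hseq : ∀ (t : ℝ≥0) (f : ℕ → Ω →ᵇ ℝ), IsBoundedTaucNull f →
      Tendsto (fun n => T t (f n)) atTop (@nhds _ (tauc Ω) 0))
    (u : ℕ → C(Ω, ℝ)) (hu : ∀ n : ℕ → ℕ, IsCompact (⋂ k, {x | u k x ≤ n k}))
    (K : Compacts Ω) {ε : ℝ} (hε : 0 < ε) (a b : ℝ≥0) :
    ∃ (M : ℝ) (K' : Compacts Ω), 0 < M ∧ ∀ t ∈ Icc a b, ∀ f : Ω →ᵇ ℝ,
      supSeminorm K (T t f) ≤ M * supSeminorm K' f + ε * ‖f‖ := by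
  obtain ⟨C₀, hC₀⟩ := hbdd a b
  have hM : 0 < max C₀ 1 := zero_lt_one.trans_le (le_max_right _ _)
  have : CompactSpace (K : Set Ω) := isCompact_iff_compactSpace.1 K.isCompact
  let Φ : Icc a b × (K : Set Ω) → (Ω →ᵇ ℝ) →ₗ[ℝ] ℝ := fun s =>
    { toFun := fun f => T s.1 f s.2
      map_add' := fun f g => by simp
      map_smul' := fun c f => by simp }
  obtain ⟨K', hK'⟩ := exists_compact_forall_abs_le (Φ := Φ)
    (fun f => hT.continuous_uncurry f _ K) (fun s f hf => by
      refine Metric.tendsto_nhds.2 fun δ hδ => ?_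
      filter_upwards [(tendsto_nhds_seminormFamily_iff _).1 (hseq s.1 f hf) K δ hδ] with n hn
      rw [sub_zero] at hn
      rw [Real.dist_eq, sub_zero]
      exact (abs_apply_le_supSeminorm (T s.1 (f n)) s.2.2).trans_lt hn)
    hM.le (fun s f => by
      refine ((T s.1 f).norm_coe_le_norm s.2).trans (((T s.1).le_opNorm f).trans ?_)
      exact mul_le_mul_of_nonneg_right ((hC₀ s.1 s.1.2).trans (le_max_left _ _)) (norm_nonneg _))
    u hu hε
  refine ⟨_, K', hM, fun t ht f => (supSeminorm_le_iff ?_).2 fun x hx => hK' (⟨t, ht⟩, ⟨x, hx⟩) f⟩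
  have := apply_nonneg (supSeminorm K') f
  positivity

/-- Composing a mixed seminorm with `T t` gives seminorms that `exists_forall_le_mul_mixedSeminorm`
can dominate: finitely many indices are handled by `h`, the tail by smallness of `a n` and the norm
bound. -/
theorem locallyBeta0Equicontinuous_of_supSeminorm_le (hbdd : LocallyNormBounded T)
    (h : ∀ (K : Compacts Ω) (ε : ℝ), 0 < ε → ∀ a b : ℝ≥0,
      ∃ (M : ℝ) (K' : Compacts Ω), 0 < M ∧ ∀ t ∈ Icc a b, ∀ f : Ω →ᵇ ℝ,
        supSeminorm K (T t f) ≤ M * supSeminorm K' f + ε * ‖f‖) :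
    LocallyBeta0Equicontinuous T := by
  intro a b V hV
  obtain ⟨s, r, hr, hV⟩ := (mem_nhds_zero_seminormFamily_iff _).1 hV
  obtain ⟨C₀, hC₀⟩ := hbdd a b
  set C := max C₀ 1
  have hC : 0 < C := zero_lt_one.trans_le (le_max_right _ _)
  have hTC : ∀ t ∈ Icc a b, ∀ f, ‖T t f‖ ≤ C * ‖f‖ := fun t ht f =>
    ((T t).le_opNorm f).trans
      (mul_le_mul_of_nonneg_right ((hC₀ t ht).trans (le_max_left _ _)) (norm_nonneg _))
  have key : ∀ i : MixedIndex Ω, ∃ (D : ℝ) (j : MixedIndex Ω), 0 < D ∧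
      ∀ t ∈ Icc a b, ∀ f, mixedSeminorm i (T t f) ≤ D * mixedSeminorm j f := by
    intro i
    obtain ⟨D, j, hD, hj⟩ := exists_forall_le_mul_mixedSeminorm
      (fun t : Icc a b => (mixedSeminorm i).comp (T t).toLinearMap) fun ε hε => by
        obtain ⟨A, hA⟩ := i.a_tendsto.bddAbove_range
        have hA : ∀ n, i.a n ≤ A := fun n => hA ⟨n, rfl⟩
        have hA0 : 0 ≤ A := (i.a_nonneg 0).trans (hA 0)
        choose M K' hM hK' using fun n => h (i.K n) (ε / (A + 1)) (by positivity) a b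
        obtain ⟨N, hN⟩ := eventually_atTop.1
          (i.a_tendsto.eventually (ge_mem_nhds (show 0 < ε / C by positivity)))
        let K := (Finset.range N).sup K'
        let M₀ := ∑ n ∈ Finset.range N, M n
        have hM₀ : 0 ≤ M₀ := Finset.sum_nonneg fun n _ => (hM n).le
        refine ⟨(A + 1) * (M₀ + 1), K, by positivity, fun t f => ?_⟩
        have hf0 := norm_nonneg f
        have hKf := apply_nonneg (supSeminorm K) f
        refine Real.iSup_le (fun n => ?_) (by positivity)
        change i.a n * supSeminorm (i.K n) (T t f) ≤ _
        rcases lt_or_ge n N with hn | hn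
        · have hnN := Finset.mem_range.2 hn
          have hKK : supSeminorm (K' n) f ≤ supSeminorm K f :=
            (supSeminorm_le_iff hKf).2 fun x hx => abs_apply_le_supSeminorm f
              (show x ∈ K from (Finset.le_sup (f := K') hnN : K' n ≤ K) hx)
          have hMM : M n ≤ M₀ + 1 :=
            (Finset.single_le_sum (f := M) (fun n _ => (hM n).le) hnN).trans (by linarith)
          calc i.a n * supSeminorm (i.K n) (T t f)
              ≤ (A + 1) * ((M₀ + 1) * supSeminorm K f + ε / (A + 1) * ‖f‖) :=
                mul_le_mul ((hA n).trans (by linarith)) ((hK' n t t.2 f).trans (add_le_add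
                  (mul_le_mul hMM hKK (apply_nonneg _ _) (by positivity)) le_rfl))
                  (apply_nonneg _ _) (by positivity)
            _ = (A + 1) * (M₀ + 1) * supSeminorm K f + ε * ‖f‖ := by field_simp
        · calc i.a n * supSeminorm (i.K n) (T t f) ≤ ε / C * (C * ‖f‖) :=
                mul_le_mul (hN n hn) ((supSeminorm_le_norm _ _).trans (hTC t t.2 f))
                  (apply_nonneg _ _) (by positivity)
            _ = ε * ‖f‖ := by field_simp
            _ ≤ _ := le_add_of_nonneg_left (by positivity)
    exact ⟨D, j, hD, fun t ht f => hj ⟨t, ht⟩ f⟩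
  choose D j hD hj using key
  refine ⟨{f | ∀ i ∈ s, mixedSeminorm (j i) f < r / D i}, ?_, fun t ht f hf => hV _ fun i hi => ?_⟩
  · refine (mem_nhds_zero_seminormFamily_iff _).2 ?_
    classical
    -- With no seminorms to control, any radius serves; otherwise the least `r / D i` is taken.
    rcases s.eq_empty_or_nonempty with rfl | hs
    · exact ⟨∅, 1, one_pos, fun f _ => by simp⟩
    · refine ⟨s.image j, s.inf' hs fun i => r / D i,
        (Finset.lt_inf'_iff _).2 fun i _ => div_pos hr (hD i), fun f hf i hi => ?_⟩
      exact (hf (j i) (Finset.mem_image_of_mem j hi)).trans_le (Finset.inf'_le _ hi)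
  · refine (hj i t ht f).trans_lt ?_
    have := (lt_div_iff₀ (hD i)).1 (hf i hi)
    rwa [mul_comm]

theorem locallyTaucBiEquicontinuous_of_supSeminorm_le
    (h : ∀ (K : Compacts Ω) (ε : ℝ), 0 < ε → ∀ a b : ℝ≥0,
      ∃ (M : ℝ) (K' : Compacts Ω), 0 < M ∧ ∀ t ∈ Icc a b, ∀ f : Ω →ᵇ ℝ,
        supSeminorm K (T t f) ≤ M * supSeminorm K' f + ε * ‖f‖) :
    LocallyTaucBiEquicontinuous T := by
  rintro f ⟨⟨C₀, hC₀⟩, hf⟩ a b V hV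
  obtain ⟨s, r, hr, hV⟩ := (mem_nhds_zero_seminormFamily_iff _).1 hV
  set C := max C₀ 1
  have hC : 0 < C := zero_lt_one.trans_le (le_max_right _ _)
  have key : ∀ K ∈ s, ∀ᶠ n in atTop, ∀ t ∈ Icc a b, supSeminorm K (T t (f n)) < r := by
    intro K _
    -- The bound `C` on the norms keeps the error term at most `r / 2`; the other half comes from
    -- `p_K'(f n) → 0`.
    obtain ⟨M, K', hM, hK'⟩ := h K (r / (2 * C)) (by positivity) a b
    filter_upwards [(tendsto_nhds_seminormFamily_iff _).1 hf K' (r / (2 * M)) (by positivity)]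
      with n hn t ht
    rw [sub_zero] at hn
    calc supSeminorm K (T t (f n)) ≤ M * supSeminorm K' (f n) + r / (2 * C) * ‖f n‖ :=
          hK' t ht (f n)
      _ < M * (r / (2 * M)) + r / (2 * C) * C :=
          add_lt_add_of_lt_of_le (mul_lt_mul_of_pos_left hn hM)
            (mul_le_mul_of_nonneg_left ((hC₀ n).trans (le_max_left _ _)) (by positivity))
      _ = r := by field_simp; ring
  filter_upwards [(Finset.eventually_all s).2 key] with n hn t ht
  exact hV _ fun K hK => hn K hK t ht

end OperatorFamilies

end CbSemigroup

theorem proposition3p3 {Ω : Type*} [TopologicalSpace Ω]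
    (hΩ : PolishSpace Ω ∨ (T2Space Ω ∧ LocallyCompactSpace Ω ∧ SigmaCompactSpace Ω))
    (T : ℝ≥0 → (Ω →ᵇ ℝ) →L[ℝ] (Ω →ᵇ ℝ))
    (hcont : CbSemigroup.TaucStronglyContinuous T)
    (hbdd : CbSemigroup.LocallyNormBounded T)
    (hseq : ∀ (t : ℝ≥0) (f : ℕ → Ω →ᵇ ℝ), CbSemigroup.IsBoundedTaucNull f →
      Tendsto (fun n => T t (f n)) atTop (@nhds _ (CbSemigroup.tauc Ω) 0)) :
    (∀ (K : Compacts Ω) (ε : ℝ), 0 < ε → ∀ a b : ℝ≥0,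
      ∃ (M : ℝ) (K' : Compacts Ω), 0 < M ∧ ∀ t ∈ Icc a b, ∀ f : Ω →ᵇ ℝ,
        CbSemigroup.supSeminorm K (T t f) ≤ M * CbSemigroup.supSeminorm K' f + ε * ‖f‖) ∧
    CbSemigroup.LocallyBeta0Equicontinuous T ∧
    CbSemigroup.LocallyTaucBiEquicontinuous T := by
  have hu : ∃ u : ℕ → C(Ω, ℝ), ∀ n : ℕ → ℕ, IsCompact (⋂ k, {x | u k x ≤ n k}) := by
    rcases hΩ with h | ⟨h1, h2, h3⟩
    · exact CbSemigroup.exists_sublevel_compact_of_polishSpace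
    · exact CbSemigroup.exists_sublevel_compact_of_sigmaCompact
  obtain ⟨u, hu⟩ := hu
  have h := fun K ε (hε : 0 < ε) =>
    CbSemigroup.exists_forall_supSeminorm_le hcont hbdd hseq u hu K hε
  exact ⟨h, CbSemigroup.locallyBeta0Equicontinuous_of_supSeminorm_le hbdd h,
    CbSemigroup.locallyTaucBiEquicontinuous_of_supSeminorm_le h⟩
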